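/- Let $F=GF(q)$ be a finite field. Consider vector matrices $\begin{pmatrix} a&\alpha\\ \beta&b\end{pmatrix}$ with $a,b\in F$, $\alpha,\beta\in F^3$, multiplied by Zorn's rule $$\begin{pmatrix} a&\alpha\\ \beta&b\end{pmatrix}\begin{pmatrix} c&\gamma\\ \delta&d\end{pmatrix}=\begin{pmatrix} ac+\alpha\cdot\delta & a\gamma+d\alpha-\beta\times\delta\\ c\beta+b\delta+\alpha\times\gamma & \beta\cdot\gamma+bd\end{pmatrix},$$ where $\cdot$ and $\times$ are the usual dot and vector products on $F^3$. The vector matrices with $ab-\alpha\cdot\beta=1$ form a loop $M(q)$ under this multiplication. The Paige loop $M^*(q)$ is the quotient of $M(q)$ by its center (the set of elements that commute and associate with all elements). Let $e_i\in F^3$ be the vector whose only nonzero coordinate is in position $i$ and is equal to $1$. Theorem. Every Paige loop $M^*(q)$ is $3$-generated, that is, it is generated as a loop by some set of three elements. When $q>3$, for every primitive element $\lambda$ of $GF(q)$ (a generator of the multiplicative group of $GF(q)$) the loop $M^*(q)$ is generated by the classes of $$\begin{pmatrix} 0&e_1\\ -e_1&\lambda\end{pmatrix},\quad \begin{pmatrix}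 0&e_2\\ -e_2&\lambda\end{pmatrix},\quad \begin{pmatrix} \lambda&0\\ 0&\lambda^{-1}\end{pmatrix}.$$ When $q=2$, the loop $M^*(2)$ is generated by the classes of $$\begin{pmatrix} 1&e_1\\ e_1&0\end{pmatrix},\quad \begin{pmatrix} 1&e_2\\ e_2&0\end{pmatrix},\quad \begin{pmatrix} 0&e_3\\ e_3&1\end{pmatrix}.$$ -/

import Mathlib

/-- A loop: a set with a binary operation and a two-sided neutral element such that the equations
`a * x = b` and `x * a = b` have a unique solution `x`, for all `a`, `b`. -/
class Loop (Q : Type*) extends MulOneClass Q where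
  existsUnique_mul_left : ∀ a b : Q, ∃! x : Q, a * x = b
  existsUnique_mul_right : ∀ a b : Q, ∃! x : Q, x * a = b

/-- A subloop: a subset that contains the neutral element and is closed under multiplication and
under left and right division. -/
structure Subloop (Q : Type*) [Loop Q] where
  carrier : Set Q
  one_mem : (1 : Q) ∈ carrier
  mul_mem : ∀ {a b : Q}, a ∈ carrier → b ∈ carrier → a * b ∈ carrier
  leftDiv_mem : ∀ {a b x : Q}, a ∈ carrier → b ∈ carrier → a * x = b → x ∈ carrier
  rightDiv_mem : ∀ {a b x : Q}, a ∈ carrier → b ∈ carrier → x * a = b → x ∈ carrier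

/-- The (underlying set of the) subloop generated by `S`: the intersection of all subloops that
contain `S`. -/
def Loop.closure {Q : Type*} [Loop Q] (S : Set Q) : Set Q :=
  {x | ∀ H : Subloop Q, S ⊆ H.carrier → x ∈ H.carrier}

theorem Loop.left_cancel {Q : Type*} [Loop Q] {a x y : Q} (h : a * x = a * y) : x = y :=
  (Loop.existsUnique_mul_left a (a * y)).unique h rfl

theorem Loop.right_cancel {Q : Type*} [Loop Q] {a x y : Q} (h : x * a = y * a) : x = y :=
  (Loop.existsUnique_mul_right a (y * a)).unique h rfl

theorem Loop.exists_center_inv {Q : Type*} [Loop Q] {z : Q} (hz : z ∈ Set.center Q) :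
    ∃ w ∈ Set.center Q, z * w = 1 := by
  obtain ⟨w, hw, -⟩ := Loop.existsUnique_mul_left z 1
  have hz' : IsMulCentral z := hz
  have key : ∀ a, z * (w * a) = a := fun a => by rw [hz'.left_assoc, hw, one_mul]
  have key' : ∀ a, z * (a * w) = a := fun a => by
    rw [hz'.left_comm, hw, mul_one]
  refine ⟨w, ⟨?_, ?_, ?_⟩, hw⟩
  · intro a
    exact Loop.left_cancel (a := z) ((key a).trans (key' a).symm)
  · intro b c
    apply Loop.left_cancel (a := z)
    rw [key, hz'.left_assoc, key]
  · intro a b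
    apply Loop.left_cancel (a := z)
    rw [key', hz'.left_comm, key']

/-- The congruence of a loop `Q` modulo its center `Z`: `x` and `y` are congruent when `y ∈ x Z`.
Here `Set.center Q` is the set of all elements that commute and associate with all elements. -/
def Loop.centerCon (Q : Type*) [Loop Q] : Con Q where
  r x y := ∃ z ∈ Set.center Q, y = x * z
  iseqv := by
    refine ⟨fun x => ⟨1, Set.one_mem_center, (mul_one x).symm⟩, ?_, ?_⟩
    · rintro x y ⟨z, hz, rfl⟩
      obtain ⟨w, hw, hzw⟩ := Loop.exists_center_inv hz
      refine ⟨w, hw, ?_⟩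
      have hw' : IsMulCentral w := hw
      rw [hw'.right_assoc, hzw, mul_one]
    · rintro x y t ⟨z, hz, rfl⟩ ⟨w, hw, rfl⟩
      have hw' : IsMulCentral w := hw
      exact ⟨z * w, Set.mul_mem_center hz hw, hw'.right_assoc x z⟩
  mul' := by
    rintro a _ c _ ⟨z, hz, rfl⟩ ⟨w, hw, rfl⟩
    have hz' : IsMulCentral z := hz
    have hw' : IsMulCentral w := hw
    refine ⟨z * w, Set.mul_mem_center hz hw, ?_⟩
    rw [← hw'.right_assoc, ← hw'.right_assoc, hz'.right_comm]

/-- The quotient `Q / Z(Q)` of a loop modulo its center is a loop. -/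
instance Loop.centerQuotient (Q : Type*) [Loop Q] : Loop (Loop.centerCon Q).Quotient where
  existsUnique_mul_left := by
    intro a b
    induction a using Con.induction_on with | H a => ?_
    induction b using Con.induction_on with | H b => ?_
    obtain ⟨x, hx, -⟩ := Loop.existsUnique_mul_left a b
    refine ⟨(x : (Loop.centerCon Q).Quotient), by
      show _ = _
      rw [← Con.coe_mul, hx], ?_⟩
    intro y hy
    induction y using Con.induction_on with | H y => ?_
    have hy' : ((a * y : Q) : (Loop.centerCon Q).Quotient) = (b : Q) := hy
    obtain ⟨z, hz, hbz⟩ := (Con.eq _).1 hy'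
    have hz' : IsMulCentral z := hz
    refine (Con.eq _).2 ⟨z, hz, Loop.left_cancel (a := a) ?_⟩
    rw [hx, hbz, hz'.right_assoc]
  existsUnique_mul_right := by
    intro a b
    induction a using Con.induction_on with | H a => ?_
    induction b using Con.induction_on with | H b => ?_
    obtain ⟨x, hx, -⟩ := Loop.existsUnique_mul_right a b
    refine ⟨(x : (Loop.centerCon Q).Quotient), by
      show _ = _
      rw [← Con.coe_mul, hx], ?_⟩
    intro y hy
    induction y using Con.induction_on with | H y => ?_
    have hy' : ((y * a : Q) : (Loop.centerCon Q).Quotient) = (b : Q) := hy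
    obtain ⟨z, hz, hbz⟩ := (Con.eq _).1 hy'
    have hz' : IsMulCentral z := hz
    refine (Con.eq _).2 ⟨z, hz, Loop.right_cancel (a := a) ?_⟩
    rw [hx, hbz, hz'.right_comm]

/-- A Zorn vector matrix with scalar diagonal entries `a`, `b` and off-diagonal entries `α`
(upper right) and `β` (lower left) in `F ^ 3`. -/
@[ext]
structure VectorMatrix (F : Type*) where
  a : F
  α : Fin 3 → F
  β : Fin 3 → F
  b : F

namespace VectorMatrix

variable {F : Type*} [Field F]

/-- The Zorn multiplication. -/
instance : Mul (VectorMatrix F) where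
  mul x y :=
    { a := x.a * y.a + dotProduct x.α y.β
      α := x.a • y.α + y.b • x.α - crossProduct x.β y.β
      β := y.a • x.β + x.b • y.β + crossProduct x.α y.α
      b := dotProduct x.β y.α + x.b * y.b }

instance : One (VectorMatrix F) where
  one := { a := 1, α := 0, β := 0, b := 1 }

/-- The determinant of a vector matrix, which is the norm of the split octonion algebra. -/
def det (x : VectorMatrix F) : F := x.a * x.b - dotProduct x.α x.β

/-- The conjugate of a vector matrix. -/
def conj (x : VectorMatrix F) : VectorMatrix F where
  a := x.b
  α := -x.α
  β := -x.β
  b := x.a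

theorem mul_def (x y : VectorMatrix F) : x * y =
    { a := x.a * y.a + dotProduct x.α y.β
      α := x.a • y.α + y.b • x.α - crossProduct x.β y.β
      β := y.a • x.β + x.b • y.β + crossProduct x.α y.α
      b := dotProduct x.β y.α + x.b * y.b } := rfl

theorem one_def : (1 : VectorMatrix F) = { a := 1, α := 0, β := 0, b := 1 } := rfl

theorem det_one : det (1 : VectorMatrix F) = 1 := by simp [det, one_def]

theorem det_mul (x y : VectorMatrix F) : det (x * y) = det x * det y := by
  simp [det, mul_def, dotProduct, cross_apply, Matrix.vecHead, Matrix.vecTail, Fin.sum_univ_three]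
  ring

theorem det_conj (x : VectorMatrix F) : det (conj x) = det x := by
  simp [det, conj, mul_comm]

theorem one_mul' (x : VectorMatrix F) : 1 * x = x := by
  ext i <;> simp [mul_def, one_def]

theorem mul_one' (x : VectorMatrix F) : x * 1 = x := by
  ext i <;> simp [mul_def, one_def]

theorem conj_mul_cancel (x y : VectorMatrix F) (hx : det x = 1) : conj x * (x * y) = y := by
  simp only [det, dotProduct, Fin.sum_univ_three] at hx
  ext i
  · simp [conj, mul_def, dotProduct, cross_apply, Matrix.vecHead, Matrix.vecTail, Fin.sum_univ_three]
    linear_combination y.a * hx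
  · fin_cases i <;> simp [conj, mul_def, dotProduct, cross_apply, Matrix.vecHead, Matrix.vecTail, Fin.sum_univ_three]
    · linear_combination y.α 0 * hx
    · linear_combination y.α 1 * hx
    · linear_combination y.α 2 * hx
  · fin_cases i <;> simp [conj, mul_def, dotProduct, cross_apply, Matrix.vecHead, Matrix.vecTail, Fin.sum_univ_three]
    · linear_combination y.β 0 * hx
    · linear_combination y.β 1 * hx
    · linear_combination y.β 2 * hx
  · simp [conj, mul_def, dotProduct, cross_apply, Matrix.vecHead, Matrix.vecTail, Fin.sum_univ_three]
    linear_combination y.b * hx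

theorem conj_conj (x : VectorMatrix F) : conj (conj x) = x := by
  simp [conj]

theorem conj_mul (x y : VectorMatrix F) : conj (x * y) = conj y * conj x := by
  ext i
  · simp [conj, mul_def, dotProduct, Fin.sum_univ_three]
    ring
  · fin_cases i <;> simp [conj, mul_def, cross_apply, Matrix.vecHead, Matrix.vecTail] <;> ring
  · fin_cases i <;> simp [conj, mul_def, cross_apply, Matrix.vecHead, Matrix.vecTail] <;> ring
  · simp [conj, mul_def, dotProduct, Fin.sum_univ_three]
    ring

end VectorMatrix

/-- `M(F)`: the vector matrices over `F` of determinant `1`. -/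
def UnitVectorMatrix (F : Type*) [Field F] : Type _ := {x : VectorMatrix F // x.det = 1}

/-- `M(F)` is a loop under the Zorn multiplication. -/
instance UnitVectorMatrix.loop (F : Type*) [Field F] : Loop (UnitVectorMatrix F) where
  mul x y := ⟨x.1 * y.1, by rw [VectorMatrix.det_mul, x.2, y.2, one_mul]⟩
  one := ⟨1, VectorMatrix.det_one⟩
  one_mul x := Subtype.ext (VectorMatrix.one_mul' x.1)
  mul_one x := Subtype.ext (VectorMatrix.mul_one' x.1)
  existsUnique_mul_left := by
    intro a b
    have ha : a.1.conj.det = 1 := by rw [VectorMatrix.det_conj, a.2]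
    refine ⟨⟨a.1.conj * b.1, by rw [VectorMatrix.det_mul, ha, b.2, one_mul]⟩, ?_, ?_⟩
    · apply Subtype.ext
      show a.1 * (a.1.conj * b.1) = b.1
      have h := VectorMatrix.conj_mul_cancel a.1.conj b.1 ha
      rwa [VectorMatrix.conj_conj] at h
    · intro y hy
      apply Subtype.ext
      have hy' : a.1 * y.1 = b.1 := congrArg Subtype.val hy
      show y.1 = a.1.conj * b.1
      rw [← hy', VectorMatrix.conj_mul_cancel _ _ a.2]
  existsUnique_mul_right := by
    intro a b
    have ha : a.1.conj.det = 1 := by rw [VectorMatrix.det_conj, a.2]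
    have key : ∀ u v : VectorMatrix F, v.det = 1 → u * v * v.conj = u := by
      intro u v hv
      have hv' : v.conj.det = 1 := by rw [VectorMatrix.det_conj, hv]
      have h2 := VectorMatrix.conj_mul_cancel v.conj u.conj hv'
      have h3 := congrArg VectorMatrix.conj h2
      simpa only [VectorMatrix.conj_conj, VectorMatrix.conj_mul] using h3
    refine ⟨⟨b.1 * a.1.conj, by rw [VectorMatrix.det_mul, ha, b.2, one_mul]⟩, ?_, ?_⟩
    · apply Subtype.ext
      show b.1 * a.1.conj * a.1 = b.1
      have h := key b.1 a.1.conj ha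
      rwa [VectorMatrix.conj_conj] at h
    · intro y hy
      apply Subtype.ext
      have hy' : y.1 * a.1 = b.1 := congrArg Subtype.val hy
      show y.1 = b.1 * a.1.conj
      rw [← hy', key _ _ a.2]

/-- The Paige loop `M*(F) = M(F) / Z(M(F))`. -/
abbrev PaigeLoop (F : Type*) [Field F] : Type _ := (Loop.centerCon (UnitVectorMatrix F)).Quotient

/-- The class in `M*(F)` of a vector matrix of determinant `1`. -/
def PaigeLoop.mk {F : Type*} [Field F] (x : VectorMatrix F) (hx : x.det = 1) : PaigeLoop F :=
  Con.toQuotient (c := Loop.centerCon (UnitVectorMatrix F)) ⟨x, hx⟩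

/-- The vector matrix with diagonal `0`, `t` and off-diagonal entries `e_i`, `-e_i`. -/
def VectorMatrix.skew {F : Type*} [Field F] (i : Fin 3) (t : F) : VectorMatrix F where
  a := 0
  α := Pi.single i 1
  β := -Pi.single i 1
  b := t

/-- The diagonal vector matrix with diagonal `t`, `t⁻¹`. -/
def VectorMatrix.diag {F : Type*} [Field F] (t : F) : VectorMatrix F where
  a := t
  α := 0
  β := 0
  b := t⁻¹

/-- The vector matrix with diagonal `s`, `t` and both off-diagonal entries equal to `e_i`. -/
def VectorMatrix.sym {F : Type*} [Field F] (i : Fin 3) (s t : F) : VectorMatrix F where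
  a := s
  α := Pi.single i 1
  β := Pi.single i 1
  b := t

theorem VectorMatrix.det_skew {F : Type*} [Field F] (i : Fin 3) (t : F) :
    (VectorMatrix.skew i t).det = 1 := by
  simp [VectorMatrix.det, VectorMatrix.skew]

theorem VectorMatrix.det_diag {F : Type*} [Field F] (t : Fˣ) :
    (VectorMatrix.diag (t : F)).det = 1 := by
  simp [VectorMatrix.det, VectorMatrix.diag]

theorem VectorMatrix.det_sym {F : Type*} [Field F] (hF : Nat.card F = 2) (i : Fin 3) {s t : F}
    (hst : s * t = 0) : (VectorMatrix.sym i s t).det = 1 := by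
  have h : Nat.card F • (1 : F) = 0 := card_nsmul_eq_zero'
  rw [hF] at h
  simp only [VectorMatrix.det, VectorMatrix.sym, hst]
  simp
  rw [two_nsmul] at h
  linear_combination -h

/-! The argument takes place among the vector matrices themselves. On determinant `1` the conjugate
is the inverse, so the preimage of a subloop of the Paige loop is closed under product and
conjugation. It suffices to show that such a set `P`, once it contains the given generators,
contains every matrix of determinant `1`.

The matrices `upper γ` and `lower δ` play the role of transvections. Products of two of them add the
vectors up to a cross product in the opposite corner; these defects can be removed, so the multiples
of the axis vectors already give all `upper γ` and `lower δ`. Row reduction as in `SL₂` then reaches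
every matrix of determinant `1` (`mem_of_det_eq_one`).

It remains to find the axis elements. For `q > 3` the generators on axes `0` and `1`, with the
diagonal one, yield a copy of `SL₂(q)` on each of these axes, and a conjugation reaches axis `2`
(`mem_of_skew_of_diag`). For `q = 3` the three unit upper matrices suffice, since a commutator word
in them is lower (`mem_of_upper`). For `q = 2` explicit words give all six unit axis elements
(`mem_of_sym`). -/

namespace VectorMatrix

/-! ### Elementary vector matrices and the `2 × 2` blocks -/

section Generation

variable {F : Type*} [Field F]

/-- The vector matrix with diagonal `1`, `1`, upper right entry `γ` and lower left entry `0`. -/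
def upper (γ : Fin 3 → F) : VectorMatrix F := ⟨1, γ, 0, 1⟩

/-- The vector matrix with diagonal `1`, `1`, upper right entry `0` and lower left entry `δ`. -/
def lower (δ : Fin 3 → F) : VectorMatrix F := ⟨1, 0, δ, 1⟩

/-- The vector matrix all of whose entries lie in the copy of the `2 × 2` matrices that belongs
to the `i`-th coordinate. -/
def block (i : Fin 3) (a s t b : F) : VectorMatrix F := ⟨a, Pi.single i s, Pi.single i t, b⟩

/-- Cross products vanish on a single axis, so Zorn's rule becomes ordinary `2 × 2` matrix
multiplication. -/
theorem block_mul (i : Fin 3) (a s t b a' s' t' b' : F) :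
    block i a s t b * block i a' s' t' b' =
      block i (a * a' + s * t') (a * s' + b' * s) (a' * t + b * t') (t * s' + b * b') := by
  have hc : ∀ x y : F, crossProduct (Pi.single i x : Fin 3 → F) (Pi.single i y) = 0 := by
    intro x y
    ext j
    fin_cases i <;> fin_cases j <;> simp [cross_apply]
  simp [block, mul_def, hc, ← Pi.single_smul, ← Pi.single_add]

theorem conj_block (i : Fin 3) (a s t b : F) :
    conj (block i a s t b) = block i b (-s) (-t) a := by
  simp [block, conj, Pi.single_neg]

theorem upper_single (i : Fin 3) (s : F) : upper (Pi.single i s) = block i 1 s 0 1 := by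
  simp [upper, block]

theorem lower_single (i : Fin 3) (s : F) : lower (Pi.single i s) = block i 1 0 s 1 := by
  simp [lower, block]

theorem skew_eq_block (i : Fin 3) (t : F) : skew i t = block i 0 1 (-1) t := by
  simp [skew, block, Pi.single_neg]

theorem diag_eq_block (i : Fin 3) (t : F) : diag t = block i t 0 0 t⁻¹ := by
  simp [diag, block]

theorem det_upper (γ : Fin 3 → F) : det (upper γ) = 1 := by simp [det, upper]

theorem det_lower (δ : Fin 3 → F) : det (lower δ) = 1 := by simp [det, lower]

theorem conj_upper (γ : Fin 3 → F) : conj (upper γ) = upper (-γ) := by simp [conj, upper]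

theorem conj_lower (δ : Fin 3 → F) : conj (lower δ) = lower (-δ) := by simp [conj, lower]

theorem upper_mul (γ : Fin 3 → F) (x : VectorMatrix F) :
    upper γ * x = ⟨x.a + dotProduct γ x.β, x.α + x.b • γ, x.β + crossProduct γ x.α, x.b⟩ := by
  simp [upper, mul_def]

theorem lower_mul (δ : Fin 3 → F) (x : VectorMatrix F) :
    lower δ * x = ⟨x.a, x.α - crossProduct δ x.β, x.a • δ + x.β, dotProduct δ x.α + x.b⟩ := by
  simp [lower, mul_def]

theorem upper_mul_upper (γ γ' : Fin 3 → F) :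
    upper γ * upper γ' = ⟨1, γ + γ', crossProduct γ γ', 1⟩ := by
  rw [upper_mul]
  simp [upper, add_comm, -cross_anticomm]

theorem lower_mul_lower (δ δ' : Fin 3 → F) :
    lower δ * lower δ' = ⟨1, -crossProduct δ δ', δ + δ', 1⟩ := by
  rw [lower_mul]
  simp [lower, -cross_anticomm]

/-- A set of vector matrices closed under multiplication and conjugation. -/
structure MulConjClosed (P : Set (VectorMatrix F)) : Prop where
  mul_mem : ∀ {x y}, x ∈ P → y ∈ P → x * y ∈ P
  conj_mem : ∀ {x}, x ∈ P → conj x ∈ P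

/-! ### Generation by the axis elements -/

namespace MulConjClosed

variable {P : Set (VectorMatrix F)} (hP : MulConjClosed P)
include hP

theorem mem_of_mul_mem {x y : VectorMatrix F} (hx : det x = 1) (hxP : x ∈ P) (h : x * y ∈ P) :
    y ∈ P := by
  rw [← conj_mul_cancel x y hx]
  exact hP.mul_mem (hP.conj_mem hxP) h

/-- The product of the two has the defect `γ × γ'` in its lower corner. This vector is orthogonal to
`γ + γ'`, so a lower factor cancels it without changing the diagonal. -/
theorem upper_add_mem {γ γ' : Fin 3 → F} (h : upper γ ∈ P) (h' : upper γ' ∈ P)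
    (hl : lower (crossProduct γ γ') ∈ P) : upper (γ + γ') ∈ P := by
  have h1 := hP.mul_mem (hP.conj_mem hl) (hP.mul_mem h h')
  rw [conj_lower, upper_mul_upper, lower_mul] at h1
  simpa [upper, dotProduct_add, dotProduct_comm (crossProduct γ γ'), -cross_anticomm] using h1

theorem lower_add_mem {δ δ' : Fin 3 → F} (h : lower δ ∈ P) (h' : lower δ' ∈ P)
    (hu : upper (crossProduct δ δ') ∈ P) : lower (δ + δ') ∈ P := by
  have h1 := hP.mul_mem hu (hP.mul_mem h h')
  rw [lower_mul_lower, upper_mul] at h1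
  simpa [lower, dotProduct_add, dotProduct_comm (crossProduct δ δ'), -cross_anticomm] using h1

theorem upper_mem (hu : ∀ i s, upper (Pi.single i s) ∈ P) (hl : ∀ i s, lower (Pi.single i s) ∈ P)
    (γ : Fin 3 → F) : upper γ ∈ P := by
  have h01 : upper (Pi.single 0 (γ 0) + Pi.single 1 (γ 1)) ∈ P := by
    refine hP.upper_add_mem (hu _ _) (hu _ _) ?_
    convert hl 2 (γ 0 * γ 1) using 2
    ext j
    fin_cases j <;> simp [cross_apply]
  -- This is the defect of adding the third coordinate. It lies in the plane of axes `0` and `1`,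
  -- and its own defect lies on axis `2`, so the recursion stops here.
  have hl01 : lower (Pi.single 0 (γ 1 * γ 2) + Pi.single 1 (-(γ 0 * γ 2))) ∈ P := by
    refine hP.lower_add_mem (hl _ _) (hl _ _) ?_
    convert hu 2 ((γ 1 * γ 2) * -(γ 0 * γ 2)) using 2
    ext j
    fin_cases j <;> simp [cross_apply]
  have h := hP.upper_add_mem h01 (hu 2 (γ 2)) (by
    convert hl01 using 2
    ext j
    fin_cases j <;> simp [cross_apply])
  convert h using 2
  ext j
  fin_cases j <;> simp

theorem lower_mem (hu : ∀ i s, upper (Pi.single i s) ∈ P) (hl : ∀ i s, lower (Pi.single i s) ∈ P)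
    (δ : Fin 3 → F) : lower δ ∈ P := by
  have h01 : lower (Pi.single 0 (δ 0) + Pi.single 1 (δ 1)) ∈ P := by
    refine hP.lower_add_mem (hl _ _) (hl _ _) ?_
    exact hP.upper_mem hu hl _
  have h := hP.lower_add_mem h01 (hl 2 (δ 2)) (hP.upper_mem hu hl _)
  convert h using 2
  ext j
  fin_cases j <;> simp

/-- Row reduction. If `a = 1`, a lower factor clears `β`, and the determinant forces the rest to be
upper. If `β ≠ 0`, an upper factor on an axis where `β` is nonzero makes `a = 1`. If `β = 0`, then
`a ≠ 0`, and a lower factor makes `β` nonzero. -/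
theorem mem_of_det_eq_one (hu : ∀ i s, upper (Pi.single i s) ∈ P)
    (hl : ∀ i s, lower (Pi.single i s) ∈ P) {x : VectorMatrix F} (hx : det x = 1) : x ∈ P := by
  have hU := hP.upper_mem hu hl
  have hL := hP.lower_mem hu hl
  have case_a_eq_one : ∀ y : VectorMatrix F, det y = 1 → y.a = 1 → y ∈ P := by
    intro y hy ha
    refine hP.mem_of_mul_mem (det_lower (-y.β)) (hL _) ?_
    convert hU y.α using 1
    rw [det, ha, dotProduct_comm] at hy
    simp only [lower_mul, upper, ha]
    congr 1
    · simp
    · simp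
    · rw [neg_dotProduct]
      linear_combination hy
  have case_β_ne_zero : ∀ y : VectorMatrix F, det y = 1 → y.β ≠ 0 → y ∈ P := by
    intro y hy hβ
    obtain ⟨i, hi⟩ := Function.ne_iff.1 hβ
    refine hP.mem_of_mul_mem (det_upper (Pi.single i ((1 - y.a) / y.β i))) (hu _ _) ?_
    refine case_a_eq_one _ (by rw [det_mul, det_upper, hy, one_mul]) ?_
    have hi' : y.β i ≠ 0 := hi
    simp only [upper_mul, single_dotProduct]
    field_simp
    ring
  by_cases hβ : x.β = 0
  · have ha : x.a ≠ 0 := by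
      intro ha
      simp [det, ha, hβ] at hx
    refine hP.mem_of_mul_mem (det_lower (Pi.single 0 1)) (hl 0 1) ?_
    refine case_β_ne_zero _ (by rw [det_mul, det_lower, hx, one_mul]) ?_
    intro h
    have h0 := congrFun h 0
    simp [lower_mul, hβ, ha] at h0
  · exact case_β_ne_zero x hx hβ

/-! ### The case `q > 3` -/

/-- Conjugation by an element of order `6` takes the second coordinate axis to the third. -/
theorem upper_two_mem (h0 : block 0 0 1 (-1) 1 ∈ P) {s : F} (h1 : lower (Pi.single 1 s) ∈ P) :
    upper (Pi.single 2 s) ∈ P := by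
  convert hP.mul_mem h0 (hP.mul_mem h1 (hP.conj_mem h0)) using 1
  ext i
  · simp [upper, lower, block, conj, mul_def, cross_apply, Matrix.vecHead, Matrix.vecTail]
  · fin_cases i <;> simp [upper, lower, block, conj, mul_def, cross_apply, Matrix.vecHead, Matrix.vecTail]
  · fin_cases i <;> simp [upper, lower, block, conj, mul_def, cross_apply, Matrix.vecHead, Matrix.vecTail]
  · simp [upper, lower, block, conj, mul_def, cross_apply, Matrix.vecHead, Matrix.vecTail]

theorem lower_two_mem (h0 : block 0 0 1 (-1) 1 ∈ P) {s : F} (h1 : upper (Pi.single 1 s) ∈ P) :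
    lower (Pi.single 2 (-s)) ∈ P := by
  convert hP.mul_mem (hP.conj_mem h0) (hP.mul_mem h1 h0) using 1
  ext i
  · simp [upper, lower, block, conj, mul_def, cross_apply, Matrix.vecHead, Matrix.vecTail]
  · fin_cases i <;> simp [upper, lower, block, conj, mul_def, cross_apply, Matrix.vecHead, Matrix.vecTail]
  · fin_cases i <;> simp [upper, lower, block, conj, mul_def, cross_apply, Matrix.vecHead, Matrix.vecTail]
  · simp [upper, lower, block, conj, mul_def, cross_apply, Matrix.vecHead, Matrix.vecTail]

theorem diag_mem {l : Fˣ} [Finite F] (hl : Subgroup.zpowers l = ⊤) (h : diag (l : F) ∈ P) {t : F}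
    (ht : t ≠ 0) : diag t ∈ P := by
  -- Exponents start at `1` because `P` is not assumed to contain the neutral element; `l ^ 0` is
  -- recovered as `l` to its order.
  have hpow : ∀ n : ℕ, diag ((l : F) ^ (n + 1)) ∈ P := by
    intro n
    induction n with
    | zero => simpa using h
    | succ n ih =>
      have := hP.mul_mem ih h
      rw [diag_eq_block 0, diag_eq_block 0, block_mul] at this
      rw [diag_eq_block 0]
      simpa [pow_succ, mul_comm] using this
  have hmem : Units.mk0 t ht ∈ Subgroup.zpowers l := hl ▸ Subgroup.mem_top _
  obtain ⟨n, hn⟩ := mem_powers_iff_mem_zpowers.2 hmem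
  have hn' : (l : F) ^ n = t := by simpa using congrArg Units.val hn
  cases n with
  | zero =>
    obtain ⟨m, hm⟩ := Nat.exists_eq_succ_of_ne_zero (orderOf_pos l).ne'
    have hm' : (l : F) ^ (m + 1) = 1 := by
      have := congrArg Units.val (pow_orderOf_eq_one l)
      rw [hm] at this
      simpa using this
    rw [← hn', pow_zero, ← hm']
    exact hpow m
  | succ n => exact hn' ▸ hpow n

/-- The admissible `s` form an additive group, stable under multiplication by squares because of
conjugation by diagonal elements. Since `q > 3`, some `t ≠ 0` has `t ^ 2 ≠ 1`, which produces a
nonzero admissible `u`. Every field element is a square (characteristic `2`) or a difference of two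
squares (otherwise), so the multiples of `u` exhaust `F`. -/
theorem block_upper_mem {i : Fin 3} [Finite F] (hF : 3 < Nat.card F) {l : F} (hl : l ≠ 0)
    (hs : block i 0 1 (-1) l ∈ P) (hd : ∀ t : F, t ≠ 0 → block i t 0 0 t⁻¹ ∈ P) (s : F) :
    block i 1 s 0 1 ∈ P := by
  have hadd : ∀ u v : F, block i 1 u 0 1 ∈ P → block i 1 v 0 1 ∈ P → block i 1 (u + v) 0 1 ∈ P := by
    intro u v hu hv
    simpa [block_mul, add_comm] using hP.mul_mem hu hv
  have hneg : ∀ u : F, block i 1 u 0 1 ∈ P → block i 1 (-u) 0 1 ∈ P := by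
    intro u hu
    simpa [conj_block] using hP.conj_mem hu
  have hsq : ∀ u t : F, block i 1 u 0 1 ∈ P → block i 1 (t ^ 2 * u) 0 1 ∈ P := by
    intro u t hu
    by_cases ht : t = 0
    · simpa [ht] using hadd _ _ hu (hneg u hu)
    · convert hP.mul_mem (hP.mul_mem (hd t ht) hu) (hP.conj_mem (hd t ht)) using 1
      simp only [conj_block, block_mul]
      congr 1 <;> field_simp <;> ring
  obtain ⟨t, ht0, ht1⟩ : ∃ t : F, t ≠ 0 ∧ t ^ 2 ≠ 1 := by
    by_contra! hcon
    have hsub : (Set.univ : Set F) ⊆ {0, 1, -1} := by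
      intro t _
      by_cases ht : t = 0
      · simp [ht]
      · rcases mul_self_eq_one_iff.1 ((sq t).symm.trans (hcon t ht)) with h | h <;> simp [h]
    have h1 := Set.ncard_le_ncard hsub (Set.toFinite _)
    rw [Set.ncard_univ] at h1
    have h2 := Set.ncard_insert_le (0 : F) {1, -1}
    have h3 := Set.ncard_insert_le (1 : F) {-1}
    rw [Set.ncard_singleton] at h3
    omega
  -- Multiplying the skew element on both sides by the diagonal element of `t⁻¹` only changes its
  -- corner from `l` to `t ^ 2 * l`; dividing by the original leaves an upper matrix.
  have hu0 : block i 1 (l * (1 - t ^ 2)) 0 1 ∈ P := by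
    have ht' := hd t⁻¹ (inv_ne_zero ht0)
    convert hP.mul_mem (hP.conj_mem hs) (hP.mul_mem (hP.mul_mem ht' hs) ht') using 1
    simp only [conj_block, block_mul]
    congr 1 <;> field_simp <;> ring
  set u := l * (1 - t ^ 2) with hu
  have hu_ne : u ≠ 0 := mul_ne_zero hl (sub_ne_zero.2 ht1.symm)
  have hs' : s = s / u * u := by field_simp
  rw [hs']
  by_cases h2 : ringChar F = 2
  · obtain ⟨r, hr⟩ := FiniteField.isSquare_of_char_two h2 (s / u)
    rw [hr, ← sq]
    exact hsq _ _ hu0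
  · have h2' : (2 : F) ≠ 0 := Ring.two_ne_zero h2
    -- With `c = s / u`, this is `c = ((c + 1) / 2) ^ 2 - ((c - 1) / 2) ^ 2`.
    have h := hadd _ _ (hsq _ ((s / u + 1) / 2) hu0) (hneg _ (hsq _ ((s / u - 1) / 2) hu0))
    convert h using 2
    field_simp
    ring

theorem block_skew_zero_mem {i : Fin 3} {l : F} (hs : block i 0 1 (-1) l ∈ P)
    (hu : ∀ s : F, block i 1 s 0 1 ∈ P) (c : F) : block i 0 1 (-1) c ∈ P := by
  simpa [block_mul] using hP.mul_mem hs (hu (l - c))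

/-- The Weyl element, the skew block with corner `0`, conjugates upper elements into lower ones. -/
theorem block_lower_mem {i : Fin 3} {l : F} (hs : block i 0 1 (-1) l ∈ P)
    (hu : ∀ s : F, block i 1 s 0 1 ∈ P) (s : F) : block i 1 0 s 1 ∈ P := by
  have hw := hP.block_skew_zero_mem hs hu 0
  simpa [block_mul, conj_block] using hP.mul_mem (hP.mul_mem hw (hu (-s))) (hP.conj_mem hw)

theorem mem_of_skew_of_diag [Finite F] (hF : 3 < Nat.card F) {l : Fˣ}
    (hl : Subgroup.zpowers l = ⊤) (h0 : skew 0 (l : F) ∈ P) (h1 : skew 1 (l : F) ∈ P)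
    (hd : diag (l : F) ∈ P) {x : VectorMatrix F} (hx : det x = 1) : x ∈ P := by
  rw [skew_eq_block] at h0 h1
  have hdb : ∀ (i : Fin 3) (t : F), t ≠ 0 → block i t 0 0 t⁻¹ ∈ P := by
    intro i t ht
    rw [← diag_eq_block]
    exact hP.diag_mem hl hd ht
  have hu0 := hP.block_upper_mem hF l.ne_zero h0 (hdb 0)
  have hu1 := hP.block_upper_mem hF l.ne_zero h1 (hdb 1)
  have hw := hP.block_skew_zero_mem h0 hu0 1
  refine hP.mem_of_det_eq_one ?_ ?_ hx
  · rw [Fin.forall_fin_succ, Fin.forall_fin_two]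
    refine ⟨fun s => ?_, fun s => ?_, fun s => hP.upper_two_mem hw ?_⟩
    · exact upper_single 0 s ▸ hu0 s
    · exact upper_single 1 s ▸ hu1 s
    · exact lower_single 1 s ▸ hP.block_lower_mem h1 hu1 s
  · rw [Fin.forall_fin_succ, Fin.forall_fin_two]
    refine ⟨fun s => ?_, fun s => ?_, fun s => ?_⟩
    · exact lower_single 0 s ▸ hP.block_lower_mem h0 hu0 s
    · exact lower_single 1 s ▸ hP.block_lower_mem h1 hu1 s
    · rw [← neg_neg s]
      exact hP.lower_two_mem hw (upper_single 1 (-s) ▸ hu1 (-s))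

theorem mem_of_axes (hF : ∀ s : F, s = 0 ∨ s = 1 ∨ s = -1)
    (hu : ∀ i, upper (Pi.single i 1) ∈ P) (hl : ∀ i, lower (Pi.single i 1) ∈ P)
    {x : VectorMatrix F} (hx : det x = 1) : x ∈ P := by
  refine hP.mem_of_det_eq_one (fun i s => ?_) (fun i s => ?_) hx
  · rcases hF s with rfl | rfl | rfl
    · have h := hP.mul_mem (hu i) (hP.conj_mem (hu i))
      rw [conj_upper, upper_mul] at h
      simpa [upper] using h
    · exact hu i
    · simpa [conj_upper, Pi.single_neg] using hP.conj_mem (hu i)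
  · rcases hF s with rfl | rfl | rfl
    · have h := hP.mul_mem (hl i) (hP.conj_mem (hl i))
      rw [conj_lower, lower_mul] at h
      simpa [lower] using h
    · exact hl i
    · simpa [conj_lower, Pi.single_neg] using hP.conj_mem (hl i)

end MulConjClosed

end Generation

end VectorMatrix
namespace VectorMatrix

/-! ### The fields with three and two elements -/

section SmallFields

variable {F : Type*} [Field F] {P : Set (VectorMatrix F)}

theorem MulConjClosed.mem_of_upper (hP : MulConjClosed P) (hF : Nat.card F = 3)
    (hu : ∀ i, upper (Pi.single i 1) ∈ P) {x : VectorMatrix F} (hx : det x = 1) : x ∈ P := by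
  have h3 : (3 : F) = 0 := by
    have h : Nat.card F • (1 : F) = 0 := card_nsmul_eq_zero'
    rw [hF] at h
    simpa using h
  -- The commutator word in `upper γ` and `upper γ'` equals the lower matrix of `-2 (γ × γ')`, and
  -- `-2 = 1` in characteristic `3`.
  have key : ∀ γ γ' : Fin 3 → F, upper γ ∈ P → upper γ' ∈ P →
      lower (crossProduct γ γ') ∈ P := by
    intro γ γ' h h'
    have h1 := hP.mul_mem h (hP.mul_mem (hP.conj_mem h')
      (hP.mul_mem (hP.conj_mem h) h'))
    rw [conj_upper, conj_upper, upper_mul_upper, upper_mul, upper_mul] at h1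
    convert h1 using 1
    simp only [lower]
    congr 1
    · simp
    · simp
    · simp only [map_add, map_neg, LinearMap.neg_apply, cross_self, one_smul]
      have hc : crossProduct γ' γ = -crossProduct γ γ' := (cross_anticomm γ γ').symm
      ext j
      simp [hc, -cross_anticomm]
      linear_combination (crossProduct γ γ' j) * h3
  have hL : ∀ i, lower (Pi.single i 1) ∈ P := by
    rw [Fin.forall_fin_succ, Fin.forall_fin_two]
    refine ⟨?_, ?_, ?_⟩
    · convert key _ _ (hu 1) (hu 2) using 2
      ext j
      fin_cases j <;> simp [cross_apply]
    · convert key _ _ (hu 2) (hu 0) using 2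
      ext j
      fin_cases j <;> simp [cross_apply]
    · convert key _ _ (hu 0) (hu 1) using 2
      ext j
      fin_cases j <;> simp [cross_apply]
  have : Finite F := Nat.finite_of_card_ne_zero (by omega)
  have : Fintype F := Fintype.ofFinite F
  refine hP.mem_of_axes (fun s => ?_) hu hL hx
  have hs := FiniteField.pow_card s
  rw [← Nat.card_eq_fintype_card, hF] at hs
  rcases mul_eq_zero.1 (show s * ((s - 1) * (s + 1)) = 0 by linear_combination hs) with h | h
  · exact Or.inl h
  · rcases mul_eq_zero.1 h with h | h
    · exact Or.inr (Or.inl (sub_eq_zero.1 h))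
    · exact Or.inr (Or.inr (eq_neg_of_add_eq_zero_left h))

theorem MulConjClosed.mem_of_sym (hP : MulConjClosed P) (hF : Nat.card F = 2)
    (hA : sym 0 1 0 ∈ P) (hB : sym 1 1 0 ∈ P) (hC : sym 2 0 1 ∈ P)
    {x : VectorMatrix F} (hx : det x = 1) : x ∈ P := by
  have h2 : (1 : F) + 1 = 0 := by
    have h : Nat.card F • (1 : F) = 0 := card_nsmul_eq_zero'
    rwa [hF, two_nsmul] at h
  have hn : (-1 : F) = 1 := by linear_combination -h2
  have word : ∀ {x y z : VectorMatrix F}, x ∈ P → y ∈ P → z ∈ P → x * (y * z) ∈ P :=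
    fun hx hy hz => hP.mul_mem hx (hP.mul_mem hy hz)
  have hA' := hP.conj_mem hA
  have hB' := hP.conj_mem hB
  have hC' := hP.conj_mem hC
  have : Finite F := Nat.finite_of_card_ne_zero (by omega)
  have : Fintype F := Fintype.ofFinite F
  refine hP.mem_of_axes ?_ ?_ ?_ hx
  · intro s
    have hs := FiniteField.pow_card s
    rw [← Nat.card_eq_fintype_card, hF] at hs
    rcases mul_eq_zero.1 (show s * (s - 1) = 0 by linear_combination hs) with h | h
    · exact Or.inl h
    · exact Or.inr (Or.inl (sub_eq_zero.1 h))
  -- Each unit axis element is a word using every generator once, conjugated or not.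
  · rw [Fin.forall_fin_succ, Fin.forall_fin_two]
    refine ⟨?_, ?_, ?_⟩
    · convert word hB' hC' hA using 1
      ext i
      rotate_left
      · fin_cases i <;> simp [upper, sym, conj, mul_def, cross_apply, Matrix.vecHead, Matrix.vecTail, hn, h2]
      · fin_cases i <;> simp [upper, sym, conj, mul_def, cross_apply, Matrix.vecHead, Matrix.vecTail, hn, h2]
      all_goals simp [upper, sym, conj, mul_def, cross_apply, Matrix.vecHead, Matrix.vecTail, hn, h2]
    · convert word hA' hC' hB using 1
      ext i
      rotate_left
      · fin_cases i <;> simp [upper, sym, conj, mul_def, cross_apply, Matrix.vecHead, Matrix.vecTail, hn, h2]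
      · fin_cases i <;> simp [upper, sym, conj, mul_def, cross_apply, Matrix.vecHead, Matrix.vecTail, hn, h2]
      all_goals simp [upper, sym, conj, mul_def, cross_apply, Matrix.vecHead, Matrix.vecTail, hn, h2]
    · convert word hA' hB hC' using 1
      ext i
      rotate_left
      · fin_cases i <;> simp [upper, sym, conj, mul_def, cross_apply, Matrix.vecHead, Matrix.vecTail, hn, h2]
      · fin_cases i <;> simp [upper, sym, conj, mul_def, cross_apply, Matrix.vecHead, Matrix.vecTail, hn, h2]
      all_goals simp [upper, sym, conj, mul_def, cross_apply, Matrix.vecHead, Matrix.vecTail, hn, h2]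
  -- In characteristic `2`, exchanging `a` with `b` and `α` with `β` is an automorphism. It
  -- conjugates each generator and swaps upper with lower, so these are the previous words with
  -- every conjugation toggled.
  · rw [Fin.forall_fin_succ, Fin.forall_fin_two]
    refine ⟨?_, ?_, ?_⟩
    · convert word hB hC hA' using 1
      ext i
      rotate_left
      · fin_cases i <;> simp [lower, sym, conj, mul_def, cross_apply, Matrix.vecHead, Matrix.vecTail, hn, h2]
      · fin_cases i <;> simp [lower, sym, conj, mul_def, cross_apply, Matrix.vecHead, Matrix.vecTail, hn, h2]
      all_goals simp [lower, sym, conj, mul_def, cross_apply, Matrix.vecHead, Matrix.vecTail, hn, h2]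
    · convert word hA hC hB' using 1
      ext i
      rotate_left
      · fin_cases i <;> simp [lower, sym, conj, mul_def, cross_apply, Matrix.vecHead, Matrix.vecTail, hn, h2]
      · fin_cases i <;> simp [lower, sym, conj, mul_def, cross_apply, Matrix.vecHead, Matrix.vecTail, hn, h2]
      all_goals simp [lower, sym, conj, mul_def, cross_apply, Matrix.vecHead, Matrix.vecTail, hn, h2]
    · convert word hA hB' hC using 1
      ext i
      rotate_left
      · fin_cases i <;> simp [lower, sym, conj, mul_def, cross_apply, Matrix.vecHead, Matrix.vecTail, hn, h2]
      · fin_cases i <;> simp [lower, sym, conj, mul_def, cross_apply, Matrix.vecHead, Matrix.vecTail, hn, h2]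
      all_goals simp [lower, sym, conj, mul_def, cross_apply, Matrix.vecHead, Matrix.vecTail, hn, h2]

end SmallFields
end VectorMatrix
-- From vector matrices to the Paige loop
section PaigeGeneration

open VectorMatrix

variable {F : Type*} [Field F]

/-- The vector matrices of determinant `1` whose class belongs to the subloop `H`. -/
def Subloop.matrices (H : Subloop (PaigeLoop F)) : Set (VectorMatrix F) :=
  {x | ∃ hx : det x = 1, PaigeLoop.mk x hx ∈ H.carrier}

theorem PaigeLoop.mk_mul_mk {x y : VectorMatrix F} (hx : det x = 1) (hy : det y = 1)
    (hxy : det (x * y) = 1) : PaigeLoop.mk x hx * PaigeLoop.mk y hy = PaigeLoop.mk (x * y) hxy :=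
  rfl

theorem PaigeLoop.mk_one : PaigeLoop.mk (1 : VectorMatrix F) det_one = 1 := rfl

theorem Subloop.mulConjClosed_matrices (H : Subloop (PaigeLoop F)) :
    MulConjClosed H.matrices where
  mul_mem := by
    rintro x y ⟨hx, hxH⟩ ⟨hy, hyH⟩
    exact ⟨by rw [det_mul, hx, hy, one_mul], H.mul_mem hxH hyH⟩
  conj_mem := by
    rintro x ⟨hx, hxH⟩
    have hc : det (conj x) = 1 := (det_conj x).trans hx
    refine ⟨hc, H.rightDiv_mem hxH H.one_mem ?_⟩
    have h : conj x * x = 1 := by simpa only [mul_one'] using conj_mul_cancel x 1 hx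
    rw [PaigeLoop.mk_mul_mk hc hx (h ▸ det_one), ← PaigeLoop.mk_one]
    congr 1

theorem PaigeLoop.closure_eq_univ {S : Set (PaigeLoop F)}
    (h : ∀ H : Subloop (PaigeLoop F), S ⊆ H.carrier → ∀ x, det x = 1 → x ∈ H.matrices) :
    Loop.closure S = Set.univ := by
  refine Set.eq_univ_of_forall fun y H hS => ?_
  induction y using Con.induction_on with | H y => ?_
  exact (h H hS y.1 y.2).2

theorem Loop.closure_mono {Q : Type*} [Loop Q] {S T : Set Q} (h : S ⊆ T) :
    Loop.closure S ⊆ Loop.closure T :=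
  fun _ hx H hT => hx H (h.trans hT)

/-- Padding a generating set to the exact size makes it unnecessary to check that three given
classes are distinct. -/
theorem Loop.exists_ncard_eq_of_closure {Q : Type*} [Loop Q] [Finite Q] {S : Set Q} {n : ℕ}
    (hS : Loop.closure S = Set.univ) (hSn : S.ncard ≤ n) (hn : n ≤ Nat.card Q) :
    ∃ T : Set Q, T.ncard = n ∧ Loop.closure T = Set.univ := by
  obtain ⟨T, hST, -, hT⟩ := Set.exists_subsuperset_card_eq (Set.subset_univ S) hSn
    (by rwa [Set.ncard_univ])
  exact ⟨T, hT, Set.eq_univ_of_univ_subset (hS ▸ Loop.closure_mono hST)⟩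

/-! ### The Paige loop has at least three elements -/

theorem UnitVectorMatrix.off_diagonal_eq_zero_of_mem_center {z : UnitVectorMatrix F}
    (hz : z ∈ Set.center (UnitVectorMatrix F)) : z.1.α = 0 ∧ z.1.β = 0 := by
  have hz' : IsMulCentral z := hz
  constructor
  · ext i
    have h : z.1 * lower (Pi.single i 1) = lower (Pi.single i 1) * z.1 :=
      congrArg Subtype.val (hz'.comm ⟨lower (Pi.single i 1), det_lower _⟩)
    have ha := congrArg VectorMatrix.a h
    simpa [mul_def, lower] using ha
  · ext i
    have h : z.1 * upper (Pi.single i 1) = upper (Pi.single i 1) * z.1 :=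
      congrArg Subtype.val (hz'.comm ⟨upper (Pi.single i 1), det_upper _⟩)
    have ha := congrArg VectorMatrix.a h
    simpa [mul_def, upper] using ha.symm

/-- A central factor has zero off-diagonal part, and comparing the `b` entries of two upper matrices
forces its own `b` entry to be `1`. Hence the Paige loop has at least `q ^ 3` elements. -/
theorem PaigeLoop.upper_injective :
    Function.Injective fun γ : Fin 3 → F => PaigeLoop.mk (upper γ) (det_upper γ) := by
  intro γ γ' h
  obtain ⟨z, hz, hzz⟩ := (Con.eq _).1 h
  obtain ⟨hα, hβ⟩ := UnitVectorMatrix.off_diagonal_eq_zero_of_mem_center hz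
  have h' : upper γ' = upper γ * z.1 := congrArg Subtype.val hzz
  rw [upper_mul, hα, hβ] at h'
  have hb : 1 = z.1.b := congrArg VectorMatrix.b h'
  have h'' : γ' = 0 + z.1.b • γ := congrArg VectorMatrix.α h'
  rw [h'', ← hb, zero_add, one_smul]

theorem VectorMatrix.finite {F : Type*} [Finite F] : Finite (VectorMatrix F) :=
  Finite.of_injective (fun x => (x.a, x.α, x.β, x.b)) fun x y h => by
    simp only [Prod.mk.injEq] at h
    exact VectorMatrix.ext h.1 h.2.1 h.2.2.1 h.2.2.2

theorem PaigeLoop.finite [Finite F] : Finite (PaigeLoop F) := by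
  have := VectorMatrix.finite (F := F)
  have : Finite (UnitVectorMatrix F) := inferInstanceAs (Finite {x : VectorMatrix F // x.det = 1})
  exact Quotient.finite _

theorem PaigeLoop.three_le_card [Finite F] : 3 ≤ Nat.card (PaigeLoop F) := by
  have := PaigeLoop.finite (F := F)
  refine le_trans ?_ (Nat.card_le_card_of_injective _ (PaigeLoop.upper_injective (F := F)))
  have h1 : 1 < Nat.card F := Finite.one_lt_card
  rw [Nat.card_fun, Nat.card_fin]
  calc 3 ≤ 2 ^ 3 := by norm_num
    _ ≤ Nat.card F ^ 3 := Nat.pow_le_pow_left h1 3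

theorem PaigeLoop.closure_skew_diag [Finite F] (hF : 3 < Nat.card F) (l : Fˣ)
    (hl : Subgroup.zpowers l = ⊤) :
    Loop.closure
      ({PaigeLoop.mk (VectorMatrix.skew 0 (l : F)) (VectorMatrix.det_skew 0 (l : F)),
        PaigeLoop.mk (VectorMatrix.skew 1 (l : F)) (VectorMatrix.det_skew 1 (l : F)),
        PaigeLoop.mk (VectorMatrix.diag (l : F)) (VectorMatrix.det_diag l)} :
          Set (PaigeLoop F)) = Set.univ := by
  refine PaigeLoop.closure_eq_univ fun H hS x hx => ?_
  exact H.mulConjClosed_matrices.mem_of_skew_of_diag hF hl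
    ⟨det_skew _ _, hS (by simp)⟩ ⟨det_skew _ _, hS (by simp)⟩ ⟨det_diag _, hS (by simp)⟩ hx

theorem PaigeLoop.closure_sym (hF : Nat.card F = 2) :
    Loop.closure
      ({PaigeLoop.mk (VectorMatrix.sym 0 1 0) (VectorMatrix.det_sym hF 0 (mul_zero 1)),
        PaigeLoop.mk (VectorMatrix.sym 1 1 0) (VectorMatrix.det_sym hF 1 (mul_zero 1)),
        PaigeLoop.mk (VectorMatrix.sym 2 0 1) (VectorMatrix.det_sym hF 2 (zero_mul 1))} :
          Set (PaigeLoop F)) = Set.univ := by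
  refine PaigeLoop.closure_eq_univ fun H hS x hx => ?_
  exact H.mulConjClosed_matrices.mem_of_sym hF ⟨det_sym hF _ (mul_zero 1), hS (by simp)⟩
    ⟨det_sym hF _ (mul_zero 1), hS (by simp)⟩ ⟨det_sym hF _ (zero_mul 1), hS (by simp)⟩ hx

theorem PaigeLoop.closure_upper (hF : Nat.card F = 3) :
    Loop.closure
      ({PaigeLoop.mk (upper (Pi.single 0 1)) (det_upper _),
        PaigeLoop.mk (upper (Pi.single 1 1)) (det_upper _),
        PaigeLoop.mk (upper (Pi.single 2 1)) (det_upper _)} : Set (PaigeLoop F)) = Set.univ := by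
  refine PaigeLoop.closure_eq_univ fun H hS x hx => ?_
  refine H.mulConjClosed_matrices.mem_of_upper hF ?_ hx
  rw [Fin.forall_fin_succ, Fin.forall_fin_two]
  exact ⟨⟨det_upper _, hS (by simp)⟩, ⟨det_upper _, hS (by simp)⟩, ⟨det_upper _, hS (by simp)⟩⟩

theorem Set.ncard_triple_le {α : Type*} (x y z : α) : ({x, y, z} : Set α).ncard ≤ 3 := by
  have h1 := Set.ncard_insert_le x {y, z}
  have h2 := Set.ncard_insert_le y {z}
  rw [Set.ncard_singleton] at h2
  omega

theorem PaigeLoop.exists_ncard_eq_three [Finite F] :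
    ∃ S : Set (PaigeLoop F), S.ncard = 3 ∧ Loop.closure S = Set.univ := by
  have := PaigeLoop.finite (F := F)
  have h1 : 1 < Nat.card F := Finite.one_lt_card
  obtain ⟨x, y, z, h⟩ : ∃ x y z : PaigeLoop F, Loop.closure {x, y, z} = Set.univ := by
    rcases lt_trichotomy (Nat.card F) 3 with hF | hF | hF
    · exact ⟨_, _, _, PaigeLoop.closure_sym (show Nat.card F = 2 by omega)⟩
    · exact ⟨_, _, _, PaigeLoop.closure_upper hF⟩
    · obtain ⟨l, hl⟩ := IsCyclic.exists_generator (α := Fˣ)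
      exact ⟨_, _, _, PaigeLoop.closure_skew_diag hF l ((Subgroup.eq_top_iff' _).2 hl)⟩
  exact Loop.exists_ncard_eq_of_closure h (Set.ncard_triple_le x y z) PaigeLoop.three_le_card

end PaigeGeneration

theorem mainTheorem10 (F : Type*) [Field F] [Finite F] :
    (∃ S : Set (PaigeLoop F), S.ncard = 3 ∧ Loop.closure S = Set.univ) ∧
    (3 < Nat.card F → ∀ l : Fˣ, Subgroup.zpowers l = ⊤ →
      Loop.closure
        ({PaigeLoop.mk (VectorMatrix.skew 0 (l : F)) (VectorMatrix.det_skew 0 (l : F)),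
          PaigeLoop.mk (VectorMatrix.skew 1 (l : F)) (VectorMatrix.det_skew 1 (l : F)),
          PaigeLoop.mk (VectorMatrix.diag (l : F)) (VectorMatrix.det_diag l)} :
            Set (PaigeLoop F)) = Set.univ) ∧
    (∀ hF : Nat.card F = 2,
      Loop.closure
        ({PaigeLoop.mk (VectorMatrix.sym 0 1 0) (VectorMatrix.det_sym hF 0 (mul_zero 1)),
          PaigeLoop.mk (VectorMatrix.sym 1 1 0) (VectorMatrix.det_sym hF 1 (mul_zero 1)),
          PaigeLoop.mk (VectorMatrix.sym 2 0 1) (VectorMatrix.det_sym hF 2 (zero_mul 1))} :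
            Set (PaigeLoop F)) = Set.univ) := by
  exact ⟨PaigeLoop.exists_ncard_eq_three, PaigeLoop.closure_skew_diag, PaigeLoop.closure_sym⟩
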